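/- Let $\mathsf F=(f_{n,k})_{n,k\ge 0}$ and $\mathsf T=(t_{n,k})_{n,k\ge 0}$ be the infinite lower-triangular matrices with entries $$f_{n,k}=\binom{n-1}{k-1}n^{n-k}\quad (n\ge k\ge 1),\qquad f_{n,0}=\delta_{n0},\qquad f_{n,k}=0\quad (k>n),$$ $$t_{n,k}=\binom{n}{k}n^{n-k}\quad (n\ge k\ge 0),\qquad t_{n,k}=0\quad (k>n),$$ where $0^0=1$ and $\delta_{n0}$ is $1$ if $n=0$ and $0$ otherwise. Then $\mathsf F$ and $\mathsf T$ are totally positive, that is, every minor of each of them is nonnegative: for all $r\ge 0$ and all indices $0\le n_1<\dots<n_r$ and $0\le k_1<\dots<k_r$, $$\det\bigl(f_{n_i,k_j}\bigr)_{1\le i,j\le r}\ge 0\qquad\text{and}\qquad \det\bigl(t_{n_i,k_j}\bigr)_{1\le i,j\le r}\ge 0 .$$ -/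

import Mathlib

/-- A (possibly infinite) real matrix with linearly ordered row and column indices is totally
positive if all of its minors are nonnegative: for every `r` and every choice of `r` rows and
`r` columns, both listed in increasing order, the determinant of the corresponding square
submatrix is nonnegative. -/
def Matrix.IsTotallyPositive {m n : Type*} [LinearOrder m] [LinearOrder n]
    (A : Matrix m n ℝ) : Prop :=
  ∀ (r : ℕ) (rows : Fin r → m) (cols : Fin r → n), StrictMono rows → StrictMono cols →
    0 ≤ (A.submatrix rows cols).det

/-- The forest numbers `f n k`: `δ_{n0}` if `k = 0`, `C(n-1, k-1) n^(n-k)` if `1 ≤ k ≤ n`, and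
`0` if `k > n`. The subtractions are evaluated only where they do not truncate. -/
def forestNumber (n k : ℕ) : ℕ :=
  if k = 0 then (if n = 0 then 1 else 0)
  else if k ≤ n then (n - 1).choose (k - 1) * n ^ (n - k)
  else 0

/-- The tree numbers `t n k = C(n, k) n^(n-k)`, which vanish for `k > n` since the binomial
coefficient does; `t 0 0 = 1`. -/
def treeNumber (n k : ℕ) : ℕ :=
  n.choose k * n ^ (n - k)

/-- The forests matrix `F`, rows and columns indexed from `0`. -/
def forestsMatrix : Matrix ℕ ℕ ℝ :=
  Matrix.of fun n k => (forestNumber n k : ℝ)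

/-- The trees matrix `T`, rows and columns indexed from `0`. -/
def treesMatrix : Matrix ℕ ℕ ℝ :=
  Matrix.of fun n k => (treeNumber n k : ℝ)

/-! Two factorizations feed each other. With L the matrix of entries n!/k! (k ≤ n) and P the Pascal
matrix, T = F L and F = 1 ⊕ (T P). L and P are totally positive, and by Cauchy–Binet nonnegativity
of minors passes to products. So if F is totally positive on its first N rows, then so are T and T
P, and the direct sum gives F on N + 1 rows. Triangularity keeps every product finite. -/

open Finset Matrix

namespace Matrix

/-- The Cauchy–Binet formula, summed over all maps of the index type instead of over subsets. -/
theorem factorial_mul_det_mul {R ι κ : Type*} [CommRing R] [Fintype ι] [DecidableEq ι]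
    [Fintype κ] (A : Matrix ι κ R) (B : Matrix κ ι R) :
    ((Fintype.card ι).factorial : R) * (A * B).det =
      ∑ f : ι → κ, (A.submatrix id f).det * (B.submatrix f id).det := by
  classical
  have expand : (A * B).det = ∑ f : ι → κ, (∏ i, A i (f i)) * (B.submatrix f id).det := by
    have h := (detRowAlternating (n := ι) (R := R)).toMultilinearMap.map_sum
      (fun i (j : κ) => A i j • B j)
    have h2 : (A * B).det = detRowAlternating (fun i => ∑ j, A i j • B j) := by
      congr 1
      ext i j
      simp [Matrix.mul_apply, Finset.sum_apply]
    rw [h2]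
    refine h.trans (Finset.sum_congr rfl fun f _ => ?_)
    refine ((detRowAlternating (n := ι) (R := R)).toMultilinearMap.map_smul_univ _ _).trans ?_
    rfl
  have twist (σ : Equiv.Perm ι) : (A * B).det = ∑ f : ι → κ,
      (((Equiv.Perm.sign σ : ℤ) : R) * ∏ i, A i (f (σ i))) * (B.submatrix f id).det := by
    rw [expand, ← (Equiv.arrowCongr σ.symm (Equiv.refl κ)).sum_comp]
    refine Finset.sum_congr rfl fun f _ => ?_
    have h3 : B.submatrix (f ∘ σ) id = (B.submatrix f id).submatrix σ id := rfl
    have h4 : (Equiv.arrowCongr σ.symm (Equiv.refl κ)) f = f ∘ σ := by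
      ext i; simp [Equiv.arrowCongr]
    rw [h4, h3, det_permute]
    simp only [Function.comp_apply]
    ring
  have h5 : ((Fintype.card ι).factorial : R) * (A * B).det =
      ∑ _σ : Equiv.Perm ι, (A * B).det := by
    simp [Finset.card_univ, Fintype.card_perm]
  rw [h5, Finset.sum_congr rfl fun σ _ => twist σ, Finset.sum_comm]
  refine Finset.sum_congr rfl fun f _ => ?_
  rw [← Finset.sum_mul, ← det_transpose (A.submatrix id f), det_apply' (A.submatrix id f)ᵀ]
  rfl

/-- In the sum over all maps, non-injective ones contribute zero; sorting an injective one changes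
both determinants by the same sign, so their product is unchanged. -/
theorem det_mul_nonneg_of_minors {r N : ℕ} (A : Matrix (Fin r) (Fin N) ℝ)
    (B : Matrix (Fin N) (Fin r) ℝ)
    (hA : ∀ f : Fin r → Fin N, StrictMono f → 0 ≤ (A.submatrix id f).det)
    (hB : ∀ f : Fin r → Fin N, StrictMono f → 0 ≤ (B.submatrix f id).det) :
    0 ≤ (A * B).det := by
  have h := factorial_mul_det_mul A B
  have hpos : (0 : ℝ) < ((Fintype.card (Fin r)).factorial : ℝ) := by positivity
  refine nonneg_of_mul_nonneg_right (h ▸ Finset.sum_nonneg fun f _ => ?_) hpos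
  by_cases hf : Function.Injective f
  · have hg : StrictMono (f ∘ Tuple.sort f) :=
      (Tuple.monotone_sort f).strictMono_of_injective (hf.comp (Tuple.sort f).injective)
    have h1 := mul_nonneg (hA _ hg) (hB _ hg)
    have h2 : A.submatrix id (f ∘ Tuple.sort f) =
      (A.submatrix id f).submatrix id (Tuple.sort f) := rfl
    have h3 : B.submatrix (f ∘ Tuple.sort f) id =
      (B.submatrix f id).submatrix (Tuple.sort f) id := rfl
    rw [h2, h3, det_permute, det_permute', mul_mul_mul_comm, ← Int.cast_mul] at h1
    simpa using h1
  · obtain ⟨i, j, hij, hne⟩ : ∃ i j, f i = f j ∧ i ≠ j := by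
      simpa [Function.Injective] using hf
    rw [det_zero_of_column_eq (M := A.submatrix id f) hne (by simp [hij]), zero_mul]

/-- Nonnegativity of all the minors of `A` that use only the first `N` rows. -/
def IsTotallyPositiveBelow (A : Matrix ℕ ℕ ℝ) (N : ℕ) : Prop :=
  ∀ (r : ℕ) (rows cols : Fin r → ℕ), StrictMono rows → StrictMono cols → (∀ i, rows i < N) →
    0 ≤ (A.submatrix rows cols).det

theorem IsTotallyPositive.below {A : Matrix ℕ ℕ ℝ} (h : A.IsTotallyPositive) (N : ℕ) :
    A.IsTotallyPositiveBelow N :=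
  fun r rows cols hr hc _ => h r rows cols hr hc

theorem isTotallyPositive_of_below {A : Matrix ℕ ℕ ℝ} (h : ∀ N, A.IsTotallyPositiveBelow N) :
    A.IsTotallyPositive := fun r rows cols hr hc =>
  h (∑ i, rows i + 1) r rows cols hr hc fun i =>
    Nat.lt_succ_of_le (Finset.single_le_sum (fun _ _ => Nat.zero_le _) (Finset.mem_univ i))

theorem IsTotallyPositiveBelow.of_eq_sum {A B C : Matrix ℕ ℕ ℝ} {N : ℕ}
    (hA : A.IsTotallyPositiveBelow N) (hB : B.IsTotallyPositiveBelow N)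
    (hC : ∀ n < N, ∀ k, C n k = ∑ m ∈ range N, A n m * B m k) :
    C.IsTotallyPositiveBelow N := by
  intro r rows cols hr hc hN
  have h : C.submatrix rows cols =
      A.submatrix rows (Fin.val : Fin N → ℕ) * B.submatrix (Fin.val : Fin N → ℕ) cols := by
    ext i j
    rw [submatrix_apply, hC _ (hN i), mul_apply, Finset.sum_range]
    rfl
  rw [h]
  refine det_mul_nonneg_of_minors _ _ (fun f hf => ?_) (fun f hf => ?_)
  · exact hA r rows (fun i => (f i : ℕ)) hr (fun i j hij => hf hij) hN
  · exact hB r (fun i => (f i : ℕ)) cols (fun i j hij => hf hij) hc fun i => (f i).2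

theorem IsTotallyPositive.scale {A : Matrix ℕ ℕ ℝ} (hA : A.IsTotallyPositive) {d e : ℕ → ℝ}
    (hd : ∀ i, 0 ≤ d i) (he : ∀ i, 0 ≤ e i) :
    (of fun i j => d i * (e j * A i j)).IsTotallyPositive := by
  intro r rows cols hr hc
  have h : (of fun i j => d i * (e j * A i j)).submatrix rows cols =
      of fun i j => d (rows i) * (of fun i j => e (cols j) * A.submatrix rows cols i j) i j := rfl
  rw [h, det_mul_column, det_mul_row]
  exact mul_nonneg (Finset.prod_nonneg fun _ _ => hd _)
    (mul_nonneg (Finset.prod_nonneg fun _ _ => he _) (hA r rows cols hr hc))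

theorem det_succ_of_row_zero {R : Type*} [CommRing R] {r : ℕ}
    (A : Matrix (Fin (r + 1)) (Fin (r + 1)) R) (h : ∀ j : Fin r, A 0 j.succ = 0) :
    A.det = A 0 0 * (A.submatrix Fin.succ Fin.succ).det := by
  rw [det_succ_row_zero, Fin.sum_univ_succ, Finset.sum_eq_zero fun j _ => by simp [h j]]
  simp [Fin.succAbove_zero]

/-- The direct sum of the `1 × 1` identity matrix and `A`. -/
def oneDirectSum (A : Matrix ℕ ℕ ℝ) : Matrix ℕ ℕ ℝ
  | 0, 0 => 1
  | 0, _ + 1 => 0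
  | _ + 1, 0 => 0
  | n + 1, k + 1 => A n k

theorem IsTotallyPositiveBelow.oneDirectSum_of_pos {A : Matrix ℕ ℕ ℝ} {N : ℕ}
    (hA : A.IsTotallyPositiveBelow N) {r : ℕ} {rows cols : Fin r → ℕ} (hr : StrictMono rows)
    (hc : StrictMono cols) (hN : ∀ i, rows i < N + 1) (hr0 : ∀ i, 0 < rows i)
    (hc0 : ∀ i, 0 < cols i) : 0 ≤ ((oneDirectSum A).submatrix rows cols).det := by
  have h : (oneDirectSum A).submatrix rows cols =
      A.submatrix (fun i => rows i - 1) (fun i => cols i - 1) := by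
    ext i j
    obtain ⟨n, hn⟩ := Nat.exists_eq_succ_of_ne_zero (hr0 i).ne'
    obtain ⟨k, hk⟩ := Nat.exists_eq_succ_of_ne_zero (hc0 j).ne'
    simp [hn, hk, oneDirectSum]
  rw [h]
  refine hA r _ _ (fun i j hij => ?_) (fun i j hij => ?_) fun i => ?_
  · have := hr hij; have := hr0 i; grind
  · have := hc hij; have := hc0 i; grind
  · have := hN i; have := hr0 i; omega

/-- The gain of one row here drives the inductions for both `pascal` and `forestsMatrix`. -/
theorem IsTotallyPositiveBelow.oneDirectSum {A : Matrix ℕ ℕ ℝ} {N : ℕ}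
    (hA : A.IsTotallyPositiveBelow N) : (oneDirectSum A).IsTotallyPositiveBelow (N + 1) := by
  intro r rows cols hr hc hN
  obtain _ | r := r
  · simp
  have pos {f : Fin (r + 1) → ℕ} (hf : StrictMono f) (j : Fin r) : 0 < f j.succ :=
    (Nat.zero_le _).trans_lt (hf (Fin.succ_pos j))
  have pos' {f : Fin (r + 1) → ℕ} (hf : StrictMono f) (h0 : 0 < f 0) (j) : 0 < f j :=
    h0.trans_le (hf.monotone (Fin.zero_le j))
  have hzero_row (k : ℕ) (hk : 0 < k) : Matrix.oneDirectSum A 0 k = 0 := by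
    obtain ⟨k, rfl⟩ := Nat.exists_eq_succ_of_ne_zero hk.ne'; rfl
  have hzero_col (k : ℕ) (hk : 0 < k) : Matrix.oneDirectSum A k 0 = 0 := by
    obtain ⟨k, rfl⟩ := Nat.exists_eq_succ_of_ne_zero hk.ne'; rfl
  rcases Nat.eq_zero_or_pos (rows 0) with hr0 | hr0 <;>
    rcases Nat.eq_zero_or_pos (cols 0) with hc0 | hc0
  · rw [det_succ_of_row_zero _ fun j => by
      rw [submatrix_apply, hr0, hzero_row _ (pos hc j)]]
    rw [submatrix_apply, hr0, hc0, submatrix_submatrix]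
    refine mul_nonneg zero_le_one (hA.oneDirectSum_of_pos (hr.comp (Fin.strictMono_succ))
      (hc.comp (Fin.strictMono_succ)) (fun i => hN _) (pos hr) (pos hc))
  · exact (det_eq_zero_of_row_eq_zero 0 fun j => by
      rw [submatrix_apply, hr0, hzero_row _ (pos' hc hc0 j)]).ge
  · exact (det_eq_zero_of_column_eq_zero 0 fun j => by
      rw [submatrix_apply, hc0, hzero_col _ (pos' hr hr0 j)]).ge
  · exact hA.oneDirectSum_of_pos hr hc hN (pos' hr hr0) (pos' hc hc0)

/-- The lower-triangular matrix with all entries on and below the diagonal equal to `1`. -/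
def lowerOnes : Matrix ℕ ℕ ℝ := of fun n k => if k ≤ n then 1 else 0

theorem lowerOnes_isTotallyPositive : lowerOnes.IsTotallyPositive := by
  intro r
  induction r with
  | zero => simp
  | succ r ih =>
    intro rows cols hr hc
    -- Either columns 0 and j+1 of the minor both consist of ones, or the first row vanishes beyond
    -- its first entry.
    by_cases h : ∃ j : Fin r, cols j.succ ≤ rows 0
    · obtain ⟨j, hj⟩ := h
      refine (det_zero_of_column_eq (Fin.succ_ne_zero j) fun i => ?_).ge
      have h1 : rows 0 ≤ rows i := hr.monotone (Fin.zero_le i)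
      have h2 : cols 0 < cols j.succ := hc (Fin.succ_pos j)
      simp only [submatrix_apply, lowerOnes, of_apply]
      rw [if_pos (by omega), if_pos (by omega)]
    · push Not at h
      rw [det_succ_of_row_zero _ fun j => by simp [lowerOnes, h j], submatrix_submatrix]
      refine mul_nonneg ?_ (ih _ _ (hr.comp Fin.strictMono_succ) (hc.comp Fin.strictMono_succ))
      simp only [submatrix_apply, lowerOnes, of_apply]
      split_ifs <;> norm_num

/-- The matrix of binomial coefficients. -/
def pascal : Matrix ℕ ℕ ℝ := of fun n k => (n.choose k : ℝ)

/-- Hockey-stick identity: Pascal's rule telescoped down a column. -/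
theorem pascal_eq_sum {N n : ℕ} (hn : n < N) (k : ℕ) :
    pascal n k = ∑ m ∈ range N, lowerOnes n m * oneDirectSum pascal m k := by
  have h : ∑ m ∈ range N, lowerOnes n m * oneDirectSum pascal m k =
      ∑ m ∈ range (n + 1), oneDirectSum pascal m k := by
    rw [← Finset.sum_subset (Finset.range_mono (Nat.succ_le_of_lt hn)) fun m _ hm => ?_]
    · refine Finset.sum_congr rfl fun m hm => ?_
      simp [lowerOnes, Nat.lt_succ_iff.1 (Finset.mem_range.1 hm)]
    · have : ¬ m ≤ n := by simpa [Nat.lt_succ_iff] using hm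
      simp [lowerOnes, this]
  rw [h]
  clear h hn
  induction n with
  | zero => cases k <;> simp [pascal, oneDirectSum]
  | succ n ih =>
    rw [Finset.sum_range_succ, ← ih]
    cases k <;> simp [pascal, oneDirectSum, Nat.choose_succ_succ, add_comm]

theorem pascal_isTotallyPositive : pascal.IsTotallyPositive := by
  refine isTotallyPositive_of_below fun N => ?_
  induction N with
  | zero =>
    intro r rows cols _ _ hN
    obtain _ | r := r
    · simp
    · exact absurd (hN 0) (by simp)
  | succ N ih =>
    exact (lowerOnes_isTotallyPositive.below _).of_eq_sum ih.oneDirectSum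
      fun n hn k => pascal_eq_sum hn k

end Matrix

/-- Absorption, (k+1) C(n,k+1) = n C(n-1,k), reduces this to Pascal's rule. Multiplied by k!, it
makes k! f(n,k) a difference of consecutive terms k! t(n,k). -/
theorem forestNumber_add_treeNumber (n k : ℕ) :
    forestNumber n k + (k + 1) * treeNumber n (k + 1) = treeNumber n k := by
  obtain _ | n := n
  · cases k <;> simp [forestNumber, treeNumber]
  obtain _ | k := k
  · simp [forestNumber, treeNumber, pow_succ, mul_comm]
  have habs : (k + 1 + 1) * (n + 1).choose (k + 1 + 1) = (n + 1) * n.choose (k + 1) := by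
    rw [Nat.add_one_mul_choose_eq, mul_comm]
  rcases lt_trichotomy k n with h | rfl | h
  · obtain ⟨d, rfl⟩ := Nat.exists_eq_add_of_lt h
    have e1 : k + d + 1 + 1 - (k + 1) = d + 1 := by omega
    have e2 : k + d + 1 + 1 - (k + 1 + 1) = d := by omega
    simp only [forestNumber, treeNumber, e1, e2]
    rw [if_neg (by omega), if_pos (by omega), ← mul_assoc, habs,
      Nat.choose_succ_succ (k + d + 1) k]
    simp only [Nat.add_sub_cancel]
    ring
  · simp [forestNumber, treeNumber]
  · simp [forestNumber, treeNumber, Nat.choose_eq_zero_of_lt, h.le, h,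
      show ¬ k ≤ n by omega, show n + 1 < k + 1 + 1 by omega]

/-- The lower-triangular matrix with entries `n! / k!`. -/
noncomputable def factorialRatio : Matrix ℕ ℕ ℝ :=
  Matrix.of fun n k => (n.factorial : ℝ) * ((k.factorial : ℝ)⁻¹ * Matrix.lowerOnes n k)

theorem factorialRatio_isTotallyPositive : factorialRatio.IsTotallyPositive :=
  Matrix.lowerOnes_isTotallyPositive.scale (fun _ => by positivity) (fun _ => by positivity)

theorem treesMatrix_eq_sum {N n : ℕ} (hn : n < N) (k : ℕ) :
    treesMatrix n k = ∑ m ∈ range N, forestsMatrix n m * factorialRatio m k := by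
  have key (m : ℕ) : forestsMatrix n m * m.factorial =
      m.factorial * treesMatrix n m - (m + 1).factorial * treesMatrix n (m + 1) := by
    have h : (forestNumber n m : ℝ) + (m + 1) * treeNumber n (m + 1) = treeNumber n m := by
      exact_mod_cast forestNumber_add_treeNumber n m
    simp only [forestsMatrix, treesMatrix, Matrix.of_apply, Nat.factorial_succ]
    push_cast
    rw [← h]
    ring
  have zero {m : ℕ} (hm : n < m) : treesMatrix n m = 0 := by
    simp [treesMatrix, treeNumber, Nat.choose_eq_zero_of_lt hm]
  have hfac : (k.factorial : ℝ) ≠ 0 := by positivity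
  -- At M = k the two branches agree, since the difference is zero there.
  have tele (M : ℕ) : ∑ m ∈ range M, forestsMatrix n m * factorialRatio m k =
      if k ≤ M then treesMatrix n k - (k.factorial : ℝ)⁻¹ * (M.factorial * treesMatrix n M)
      else 0 := by
    induction M with
    | zero =>
      split_ifs with h
      · obtain rfl : k = 0 := by omega
        simp
      · simp
    | succ M ih =>
      have hterm : forestsMatrix n M * factorialRatio M k =
          (k.factorial : ℝ)⁻¹ * (forestsMatrix n M * M.factorial) * Matrix.lowerOnes M k := by
        simp only [factorialRatio, Matrix.of_apply]
        ring
      rw [Finset.sum_range_succ, ih, hterm, key]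
      rcases lt_trichotomy k (M + 1) with h | rfl | h
      · rw [if_pos (by omega), if_pos (by omega)]
        simp only [Matrix.lowerOnes, Matrix.of_apply, if_pos (Nat.lt_succ_iff.1 h)]
        ring
      · simp [Matrix.lowerOnes, hfac]
      · rw [if_neg (by omega), if_neg (by omega)]
        simp [Matrix.lowerOnes, show ¬ k ≤ M by omega]
  rw [tele, zero hn]
  split_ifs with h
  · simp
  · exact zero (by omega)

/-- Expand (n+1)^(n-k) by the binomial theorem and use C(n,m) C(m,k) = C(n,k) C(n-k,m-k). -/
theorem forestNumber_succ_succ (n k : ℕ) :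
    forestNumber (n + 1) (k + 1) = ∑ m ∈ range (n + 1), treeNumber n m * m.choose k := by
  rcases lt_or_ge n k with h | h
  · rw [Finset.sum_eq_zero fun m hm => ?_]
    · simp [forestNumber, show ¬ k ≤ n by omega]
    · rw [Nat.choose_eq_zero_of_lt (n := m), mul_zero]
      have := Finset.mem_range.1 hm
      omega
  obtain ⟨d, rfl⟩ := Nat.exists_eq_add_of_le h
  rw [show k + d + 1 = k + (d + 1) by ring, Finset.sum_range_add, Finset.sum_eq_zero, zero_add]
  · have e : (k + d + 1) ^ d = ∑ j ∈ range (d + 1), (k + d) ^ (d - j) * d.choose j := by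
      rw [add_comm, add_pow]
      simp
    have e2 : forestNumber (k + (d + 1)) (k + 1) = (k + d).choose k * (k + d + 1) ^ d := by
      simp only [forestNumber]
      rw [if_neg (by omega), if_pos (by omega), show k + (d + 1) - (k + 1) = d by omega]
      rfl
    rw [e2, e, Finset.mul_sum]
    refine Finset.sum_congr rfl fun j hj => ?_
    have hj' : j ≤ d := Nat.lt_succ_iff.1 (Finset.mem_range.1 hj)
    have h1 := Nat.choose_mul (n := k + d) (k := k + j) (s := k) (by omega)
    rw [show k + d - k = d by omega, show k + j - k = j by omega] at h1
    rw [treeNumber, show k + d - (k + j) = d - j by omega, mul_right_comm, h1]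
    ring
  · intro m hm
    rw [Nat.choose_eq_zero_of_lt (Finset.mem_range.1 hm), mul_zero]

/-- The product of the trees matrix and the Pascal matrix. -/
def treesMulPascal : Matrix ℕ ℕ ℝ :=
  Matrix.of fun n k => ∑ m ∈ range (n + 1), treesMatrix n m * Matrix.pascal m k

theorem treesMulPascal_eq_sum {N n : ℕ} (hn : n < N) (k : ℕ) :
    treesMulPascal n k = ∑ m ∈ range N, treesMatrix n m * Matrix.pascal m k := by
  refine Finset.sum_subset (Finset.range_mono (Nat.succ_le_of_lt hn)) fun m _ hm => ?_
  have : n < m := by simpa using hm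
  simp [treesMatrix, treeNumber, Nat.choose_eq_zero_of_lt this]

theorem forestsMatrix_eq_oneDirectSum :
    forestsMatrix = Matrix.oneDirectSum treesMulPascal := by
  ext n k
  cases n <;> cases k <;>
    simp [forestsMatrix, Matrix.oneDirectSum, treesMulPascal, treesMatrix, Matrix.pascal,
      forestNumber_succ_succ]
  all_goals simp [forestNumber]

theorem treesMatrix_below {N : ℕ} (h : forestsMatrix.IsTotallyPositiveBelow N) :
    treesMatrix.IsTotallyPositiveBelow N :=
  h.of_eq_sum (factorialRatio_isTotallyPositive.below N) fun _ hn k => treesMatrix_eq_sum hn k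

theorem forestsMatrix_below (N : ℕ) : forestsMatrix.IsTotallyPositiveBelow N := by
  induction N with
  | zero =>
    intro r rows cols _ _ hN
    obtain _ | r := r
    · simp
    · exact absurd (hN 0) (by simp)
  | succ N ih =>
    rw [forestsMatrix_eq_oneDirectSum]
    exact ((treesMatrix_below ih).of_eq_sum (Matrix.pascal_isTotallyPositive.below N)
      fun _ hn k => treesMulPascal_eq_sum hn k).oneDirectSum

theorem theorem1p1 :
    forestsMatrix.IsTotallyPositive ∧ treesMatrix.IsTotallyPositive := by
  exact ⟨Matrix.isTotallyPositive_of_below forestsMatrix_below,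
    Matrix.isTotallyPositive_of_below fun N => treesMatrix_below (forestsMatrix_below N)⟩
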